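/- Let $t$ be a positive integer. A partition $\lambda=(\lambda_1\ge\lambda_2\ge\cdots)$, extended by $\lambda_i=0$ beyond its length, is a *$t$-core* if none of its hook lengths is divisible by $t$. For a box $\square$ of a partition, $h_\square$ denotes its hook length in that partition and $c_\square=j-i$ its content if it lies in row $i$ and column $j$. For $1\le i\le t-1$ put $\beta_i(\lambda)=\#\{\square\in\lambda : h_\square=t-i\}$. There is a bijection $\psi_t:\lambda\mapsto\mu$ from the set of $t$-cores onto the set of all partitions $\mu$ of length at most $t-1$ with $\{\mu_i-i \bmod t : i=1,\dots,t\}=\{0,1,\dots,t-1\}$, such that for every $t$-core $\lambda$, with $\mu=\psi_t(\lambda)$, $$|\lambda| = -|\mu|\,\frac{|\mu|+t+t^2}{2t^2}+\sum_{i=1}^t\frac{\mu_i^2+2(t+1-i)\mu_i}{2t},$$ and, for every field $F$ and every function $\tau:\mathbb{Z}\to F$ for which none of the denominators $\tau(h_\square)$ ($\square\in\lambda$), $\tau(i)$ ($1\le i\le t-1$) and $\tau(h_\square)$ ($\square\in\mu$) below is zero, $$\prod_{\square\in\lambda}\frac{\tau(h_\square-t)\,\tau(h_\square+t)}{\tau(h_\square)^2}=\prod_{i=1}^{t-1}\Bigl(\frac{\tau(-i)}{\tau(i)}\Bigr)^{\beta_i(\lambda)}\prod_{\square\in\mu}\frac{\tau(t+c_\square)}{\tau(h_\square)}.$$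 The bijection $\psi_t$ depends on $t$ only, not on $F$ or $\tau$. -/

import Mathlib

namespace MultisetHook

/-- The hook length of the box in row `c.1` and column `c.2` (both counted from `0`) of a Young
diagram: the boxes to its right, the boxes below it, and the box itself. -/
def hookLength (l : YoungDiagram) (c : ℕ × ℕ) : ℕ :=
  (l.rowLen c.1 - (c.2 + 1)) + (l.colLen c.2 - (c.1 + 1)) + 1

/-- The content of a box: its column index minus its row index. -/
def content (c : ℕ × ℕ) : ℤ := (c.2 : ℤ) - (c.1 : ℤ)

/-- A partition is a `t`-core if none of its hook lengths is a multiple of `t`. -/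
def IsCore (t : ℕ) (l : YoungDiagram) : Prop :=
  ∀ c ∈ l.cells, ¬ t ∣ hookLength l c

/-- The number of boxes of `l` whose hook length is `t - i`. -/
def beta (t : ℕ) (l : YoungDiagram) (i : ℕ) : ℕ :=
  (l.cells.filter (fun c => hookLength l c + i = t)).card

/-- Partitions `m` of length at most `t - 1` such that the residues modulo `t` of `mᵢ - i`, for
`i = 1, …, t`, are exactly `0, …, t - 1`. The `(i + 1)`-st part of `m` is `m.rowLen i`. -/
def IsResiduePartition (t : ℕ) (m : YoungDiagram) : Prop :=
  m.rowLens.length ≤ t - 1 ∧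
    (Finset.range t).image (fun i : ℕ => ((m.rowLen i : ℤ) - ((i : ℤ) + 1)) % (t : ℤ)) =
      Finset.Ico (0 : ℤ) (t : ℤ)

end MultisetHook

/-!
A Young diagram is encoded by its beads, the numbers `lᵢ - i` for all `i ≥ 1`. The integers that are
not beads are its gaps, one for each column, and the hook lengths are the positive differences
between a bead and a gap (`prod_hookLength`). The diagram is a `t`-core exactly when the beads in
each residue class modulo `t` are all members of the class below some number, so that a `t`-core is
the same as a vector of integers `n 0, …, n (t - 1)`, where `t * n r + r` is the least gap in the
class of `r`; counting beads shows that the `n r` sum to `0`, and every such vector occurs. On the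
other hand, the first `t` beads of a residue partition represent each residue class once; a shift
makes them the numbers `t * n r + r` of exactly one vector with sum `0`. This gives the bijection
(`exists_bijOn_corresponds`).

For the product formula, let `v > w` be two least gaps, `q = (v - w) / t` and `ρ = (v - w) % t`. The
pair contributes the hook lengths `v - w - t * k` for `1 ≤ k ≤ q`, each `k` times
(`prod_hookLength_core`), so that the product of the ratios telescopes to
`τ (v - w) * τ (ρ - t) ^ q / τ ρ ^ (q + 1)` (`prod_hook_ratio`). The factors with `beta` are
the product of `(τ (ρ - t) / τ (t - ρ)) ^ q` (`prod_pow_beta`), and the factors from the residue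
partition are the product of the `τ (v - w)` divided by the product of `τ (j - i)` over
`0 ≤ i < j < t` (`prod_hook_mul_prod_sub`). It remains to see that the product of
`τ ρ ^ (q + 1) / τ (t - ρ) ^ q` is that same denominator, whatever the vector `n`
(`prod_residue_powers`); this holds because the `n r` sum to `0`.

The size formula is the product formula for `τ z = 2 ^ (z ^ 2)`: the second difference of `z ^ 2` is
constant, so each box of the core contributes `2 ^ (2 * t ^ 2)`, and the right-hand side is computed
from the sum of `(x - y) ^ 2` over pairs of beads (`sum_lt_sub_sq`).
-/

namespace MultisetHook

open Finset

/-! ### Beads and gaps of a Young diagram -/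

/-- The bead of row `i`: with rows counted from `0`, this is the number `lᵢ₊₁ - (i + 1)`. -/
def bead (l : YoungDiagram) (i : ℕ) : ℤ := (l.rowLen i : ℤ) - ((i : ℤ) + 1)

/-- The gap of column `j`. The beads and the gaps together are all integers, each taken exactly once,
and the hook length of the box `(i, j)` is `bead l i - gap l j`. -/
def gap (l : YoungDiagram) (j : ℕ) : ℤ := (j : ℤ) - (l.colLen j : ℤ)

/-- The set of all beads of `l`, including those of its empty rows. -/
def beads (l : YoungDiagram) : Set ℤ := Set.range (bead l)

/-- The beads of the first `n` rows. If `l` has at most `n` rows, these are the beads that are at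
least `-n`. -/
def topBeads (l : YoungDiagram) (n : ℕ) : Finset ℤ := (range n).image (bead l)

theorem bead_strictAnti (l : YoungDiagram) : StrictAnti (bead l) := by
  intro i j h
  have := l.rowLen_anti i j h.le
  simp only [bead]
  omega

theorem gap_strictMono (l : YoungDiagram) : StrictMono (gap l) := by
  intro i j h
  have := l.colLen_anti i j h.le
  simp only [gap]
  omega

theorem hookLength_eq {l : YoungDiagram} {c : ℕ × ℕ} (h : c ∈ l.cells) :
    (hookLength l c : ℤ) = bead l c.1 - gap l c.2 := by
  obtain ⟨i, j⟩ := c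
  have h1 : j < l.rowLen i := YoungDiagram.mem_iff_lt_rowLen.1 ((YoungDiagram.mem_cells _).1 h)
  have h2 : i < l.colLen j := YoungDiagram.mem_iff_lt_colLen.1 ((YoungDiagram.mem_cells _).1 h)
  simp only [hookLength, bead, gap]
  omega

theorem gap_lt_bead_iff {l : YoungDiagram} {i j : ℕ} : gap l j < bead l i ↔ (i, j) ∈ l := by
  have h1 : (i, j) ∈ l ↔ j < l.rowLen i := YoungDiagram.mem_iff_lt_rowLen
  have h2 : (i, j) ∈ l ↔ i < l.colLen j := YoungDiagram.mem_iff_lt_colLen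
  by_cases h : (i, j) ∈ l
  · have a := h1.1 h
    have b := h2.1 h
    simp only [gap, bead, h, iff_true]
    omega
  · have a := mt h1.2 h
    have b := mt h2.2 h
    simp only [gap, bead, h, iff_false]
    omega

theorem gap_notMem_beads (l : YoungDiagram) (j : ℕ) : gap l j ∉ beads l := by
  rintro ⟨i, hi⟩
  have h0 : ¬ gap l j < bead l i := by omega
  have h1 := mt YoungDiagram.mem_iff_lt_rowLen.2 (mt gap_lt_bead_iff.2 h0)
  have h2 := mt YoungDiagram.mem_iff_lt_colLen.2 (mt gap_lt_bead_iff.2 h0)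
  simp only [gap, bead] at hi
  omega

theorem exists_bead_lt (l : YoungDiagram) (z : ℤ) : ∃ i, bead l i < z := by
  refine ⟨(l.rowLen 0 - z).toNat, ?_⟩
  have := l.rowLen_anti 0 (l.rowLen 0 - z).toNat (Nat.zero_le _)
  simp only [bead]
  omega

/-- If `i` is the first row whose bead is below `z`, then `z` is the gap of column `z + i`. -/
theorem exists_gap_of_notMem_beads {l : YoungDiagram} {z : ℤ} (hz : z ∉ beads l) :
    ∃ j, gap l j = z := by
  classical
  have hex := exists_bead_lt l z
  set i := Nat.find hex with hi
  have h1 : bead l i < z := Nat.find_spec hex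
  refine ⟨(z + i).toNat, ?_⟩
  have h2 : (i, (z + i).toNat) ∉ l := by
    rw [YoungDiagram.mem_iff_lt_rowLen]
    simp only [bead] at h1
    omega
  rw [YoungDiagram.mem_iff_lt_colLen] at h2
  have h3 : i ≤ l.colLen (z + i).toNat := by
    rcases Nat.eq_zero_or_pos i with h0 | h0
    · omega
    · have h4 := Nat.find_min hex (m := i - 1) (by omega)
      have h5 : bead l (i - 1) ≠ z := fun h => hz ⟨_, h⟩
      have h6 : (i - 1, (z + i).toNat) ∈ l := by
        rw [YoungDiagram.mem_iff_lt_rowLen]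
        simp only [bead] at h1 h4 h5
        omega
      rw [YoungDiagram.mem_iff_lt_colLen] at h6
      omega
  simp only [gap]
  simp only [bead] at h1
  omega

theorem rowLen_eq_zero {l : YoungDiagram} {n i : ℕ} (hn : l.colLen 0 ≤ n) (hi : n ≤ i) :
    l.rowLen i = 0 := by
  by_contra h
  have h1 : (i, 0) ∈ l := YoungDiagram.mem_iff_lt_rowLen.2 (Nat.pos_of_ne_zero h)
  have := YoungDiagram.mem_iff_lt_colLen.1 h1
  omega

theorem colLen_zero_le {l : YoungDiagram} {n : ℕ} (hn : l.rowLen n = 0) : l.colLen 0 ≤ n := by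
  by_contra h
  have h1 : (n, 0) ∈ l := YoungDiagram.mem_iff_lt_colLen.2 (by omega)
  have := YoungDiagram.mem_iff_lt_rowLen.1 h1
  omega

theorem mem_topBeads {l : YoungDiagram} {n : ℕ} (hn : l.colLen 0 ≤ n) {z : ℤ} :
    z ∈ topBeads l n ↔ -(n : ℤ) ≤ z ∧ z ∈ beads l := by
  simp only [topBeads, mem_image, mem_range, beads, Set.mem_range]
  constructor
  · rintro ⟨i, hi, rfl⟩
    refine ⟨?_, i, rfl⟩
    simp only [bead]
    omega
  · rintro ⟨h, i, rfl⟩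
    refine ⟨i, ?_, rfl⟩
    by_contra hi
    have := rowLen_eq_zero hn (i := i) (by omega)
    simp only [bead] at h
    omega

theorem mem_beads_of_lt {l : YoungDiagram} {n : ℕ} (hn : l.colLen 0 ≤ n) {z : ℤ}
    (hz : z < -(n : ℤ)) : z ∈ beads l := by
  refine ⟨(-z - 1).toNat, ?_⟩
  have := rowLen_eq_zero hn (i := (-z - 1).toNat) (by omega)
  simp only [bead]
  omega

theorem mem_beads_iff {l : YoungDiagram} {n : ℕ} (hn : l.colLen 0 ≤ n) {z : ℤ} :
    z ∈ beads l ↔ z < -(n : ℤ) ∨ z ∈ topBeads l n := by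
  rw [mem_topBeads hn]
  constructor
  · intro h
    by_cases hz : z < -(n : ℤ)
    · exact Or.inl hz
    · exact Or.inr ⟨by omega, h⟩
  · rintro (h | h)
    · exact mem_beads_of_lt hn h
    · exact h.2

theorem card_topBeads (l : YoungDiagram) (n : ℕ) : (topBeads l n).card = n := by
  rw [topBeads, card_image_of_injective _ (bead_strictAnti l).injective, card_range]

@[to_additive]
theorem prod_topBeads {M : Type*} [CommMonoid M] (l : YoungDiagram) (n : ℕ) (f : ℤ → M) :
    ∏ x ∈ topBeads l n, f x = ∏ i ∈ range n, f (bead l i) := by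
  rw [topBeads, prod_image (fun a _ b _ h => (bead_strictAnti l).injective h)]

theorem eq_of_rowLen_eq {l m : YoungDiagram} (h : ∀ i, l.rowLen i = m.rowLen i) : l = m := by
  ext ⟨i, j⟩
  simp only [YoungDiagram.mem_cells, YoungDiagram.mem_iff_lt_rowLen, h]

theorem beads_injective : Function.Injective beads := by
  intro l m h
  have h1 : bead l = bead m := by
    have hl : StrictMono (fun i => OrderDual.toDual (bead l i)) := (bead_strictAnti l).dual_right
    have hm : StrictMono (fun i => OrderDual.toDual (bead m i)) := (bead_strictAnti m).dual_right
    exact (hl.range_inj hm).1 h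
  refine eq_of_rowLen_eq fun i => ?_
  have := congrFun h1 i
  simp only [bead] at this
  omega

/-- The hook lengths of `l`, with multiplicity, are the positive differences between a bead and a
gap. All gaps are at least `-n` if `l` has at most `n` rows. -/
@[to_additive]
theorem prod_hookLength {M : Type*} [CommMonoid M] {l : YoungDiagram} {n : ℕ}
    (hn : l.colLen 0 ≤ n) (f : ℤ → M) :
    ∏ c ∈ l.cells, f (hookLength l c) =
      ∏ x ∈ topBeads l n, ∏ z ∈ Ico (-(n : ℤ)) x \ topBeads l n, f (x - z) := by
  rw [prod_sigma']
  refine prod_bij (fun c _ => ⟨bead l c.1, gap l c.2⟩) ?_ ?_ ?_ ?_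
  · rintro ⟨i, j⟩ hc
    have hc' : (i, j) ∈ l := (YoungDiagram.mem_cells _).1 hc
    have h0 := YoungDiagram.mem_iff_lt_colLen.1 hc'
    have h1 := l.colLen_anti 0 j (Nat.zero_le _)
    simp only [mem_sigma, mem_sdiff, mem_Ico, mem_topBeads hn, gap_notMem_beads, and_false,
      not_false_eq_true, and_true]
    refine ⟨⟨?_, i, rfl⟩, ?_, gap_lt_bead_iff.2 hc'⟩
    · simp only [bead]
      omega
    · simp only [gap]
      omega
  · rintro ⟨i, j⟩ _ ⟨i', j'⟩ _ h
    simp only [Sigma.mk.injEq, heq_eq_eq] at h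
    rw [(bead_strictAnti l).injective h.1, (gap_strictMono l).injective h.2]
  · rintro ⟨x, z⟩ h
    simp only [mem_sigma, mem_sdiff, mem_Ico, mem_topBeads hn] at h
    obtain ⟨⟨_, i, rfl⟩, ⟨h1, h2⟩, h3⟩ := h
    obtain ⟨j, rfl⟩ := exists_gap_of_notMem_beads fun hz => h3 ⟨h1, hz⟩
    exact ⟨(i, j), (YoungDiagram.mem_cells _).2 (gap_lt_bead_iff.1 h2), rfl⟩
  · intro c hc
    rw [hookLength_eq hc]

@[to_additive]
theorem prod_cells {M : Type*} [CommMonoid M] {l : YoungDiagram} {n : ℕ}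
    (hn : l.colLen 0 ≤ n) (f : ℕ × ℕ → M) :
    ∏ c ∈ l.cells, f c = ∏ i ∈ range n, ∏ j ∈ range (l.rowLen i), f (i, j) := by
  rw [prod_sigma']
  refine prod_bij' (fun c _ => ⟨c.1, c.2⟩) (fun c _ => (c.1, c.2)) ?_ ?_ ?_ ?_ ?_
  · rintro ⟨i, j⟩ hc
    have hc' : (i, j) ∈ l := (YoungDiagram.mem_cells _).1 hc
    have h0 := YoungDiagram.mem_iff_lt_colLen.1 hc'
    have h1 := l.colLen_anti 0 j (Nat.zero_le _)
    simp only [mem_sigma, mem_range]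
    exact ⟨by omega, YoungDiagram.mem_iff_lt_rowLen.1 hc'⟩
  · rintro ⟨i, j⟩ h
    simp only [mem_sigma, mem_range] at h
    exact (YoungDiagram.mem_cells _).2 (YoungDiagram.mem_iff_lt_rowLen.2 h.2)
  · intros; rfl
  · intros; rfl
  · intros; rfl

theorem card_eq_sum_rowLen {l : YoungDiagram} {n : ℕ} (hn : l.colLen 0 ≤ n) :
    l.card = ∑ i ∈ range n, l.rowLen i := by
  simpa [YoungDiagram.card] using sum_cells hn (fun _ => (1 : ℕ))

theorem exists_rowLen_eq {n : ℕ} {a : ℕ → ℕ} (ha : Antitone a) (hn : ∀ i, n ≤ i → a i = 0) :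
    ∃ l : YoungDiagram, ∀ i, l.rowLen i = a i := by
  let l : YoungDiagram :=
    { cells := (range n ×ˢ range (a 0)).filter fun c => c.2 < a c.1
      isLowerSet := by
        rintro ⟨i, j⟩ ⟨i', j'⟩ hle h
        have h1 : i' ≤ i := hle.1
        have h2 : j' ≤ j := hle.2
        have h3 := ha h1
        simp only [coe_filter, mem_product, mem_range, Set.mem_ofPred_eq] at h ⊢
        omega }
  have hl : ∀ i j, (i, j) ∈ l ↔ j < a i := by
    intro i j
    rw [← YoungDiagram.mem_cells]
    simp only [l, mem_filter, mem_product, mem_range]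
    refine ⟨fun h => h.2, fun h => ⟨⟨?_, ?_⟩, h⟩⟩
    · by_contra hi
      have := hn i (by omega)
      omega
    · exact h.trans_le (ha (Nat.zero_le i))
  refine ⟨l, fun i => ?_⟩
  refine eq_of_forall_lt_iff fun j => ?_
  rw [← hl, YoungDiagram.mem_iff_lt_rowLen]

/-- Any set of `n` integers, all at least `-n`, is the set of beads of the first `n` rows of a
diagram with at most `n` rows. -/
theorem exists_topBeads_eq {X : Finset ℤ} {n : ℕ} (hX : X.card = n)
    (hlow : ∀ x ∈ X, -(n : ℤ) ≤ x) :
    ∃ l : YoungDiagram, l.colLen 0 ≤ n ∧ topBeads l n = X := by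
  classical
  let e : Fin n → ℤ := fun i => X.orderEmbOfFin hX i.rev
  have he : StrictAnti e := fun i j h => (X.orderEmbOfFin hX).strictMono (Fin.rev_lt_rev.2 h)
  have hstep : ∀ (d i : ℕ) (h : i + d < n), e ⟨i + d, h⟩ + d ≤ e ⟨i, by omega⟩ := by
    intro d
    induction d with
    | zero => intro i h; simp
    | succ d ih =>
      intro i h
      have h1 := ih i (by omega)
      have h2 : e ⟨i + (d + 1), h⟩ < e ⟨i + d, by omega⟩ := he (by simp [Fin.lt_def])
      push_cast
      omega
  have hmem : ∀ i, e i ∈ X := fun i => X.orderEmbOfFin_mem hX _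
  have hpos : ∀ (i : ℕ) (h : i < n), 0 ≤ e ⟨i, h⟩ + i + 1 := by
    intro i h
    have h1 := hstep (n - 1 - i) i (by omega)
    have h2 := hlow _ (hmem ⟨i + (n - 1 - i), by omega⟩)
    omega
  let a : ℕ → ℕ := fun i => if h : i < n then (e ⟨i, h⟩ + i + 1).toNat else 0
  have ha : Antitone a := by
    refine antitone_nat_of_succ_le fun i => ?_
    simp only [a]
    split_ifs with h1 h2
    · have := hstep 1 i h1
      push_cast at this ⊢
      omega
    · omega
    · omega
    · omega
  obtain ⟨l, hl⟩ := exists_rowLen_eq (n := n) ha (fun i hi => by simp [a, hi])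
  refine ⟨l, colLen_zero_le (by rw [hl]; simp [a]), ?_⟩
  refine eq_of_subset_of_card_le ?_ (by rw [card_topBeads, hX])
  intro x hx
  simp only [topBeads, mem_image, mem_range] at hx
  obtain ⟨i, hi, rfl⟩ := hx
  have h1 := hpos i hi
  have h2 : bead l i = e ⟨i, hi⟩ := by
    simp only [bead, hl, a, hi, dite_true]
    omega
  rw [h2]
  exact hmem _

/-! ### Cores and charge vectors -/

section

variable {t : ℕ}

/-- `n` is a charge vector of `l`: in each residue class `r` modulo `t`, the beads of `l` are the
numbers `t * k + r` with `k < n r`. Only the values of `n` on `0, …, t - 1` matter. -/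
def IsCoreVector (t : ℕ) (l : YoungDiagram) (n : ℤ → ℤ) : Prop :=
  ∀ z : ℤ, z ∈ beads l ↔ z / t < n (z % t)

/-- The numbers `t * n r + r` for `r = 0, …, t - 1`: when `n` is a charge vector, the least gap in
each residue class. -/
noncomputable def firstGaps (t : ℕ) (n : ℤ → ℤ) : Finset ℤ :=
  (Ico (0 : ℤ) t).image fun r => t * n r + r

theorem ediv_of_mem_Ico {r : ℤ} (hr : r ∈ Ico (0 : ℤ) t) (k : ℤ) : (t * k + r) / t = k := by
  rw [mem_Ico] at hr
  rw [Int.mul_add_ediv_left _ _ (by omega), Int.ediv_eq_zero_of_lt hr.1 hr.2, add_zero]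

theorem emod_of_mem_Ico {r : ℤ} (hr : r ∈ Ico (0 : ℤ) t) (k : ℤ) : (t * k + r) % t = r := by
  rw [mem_Ico] at hr
  rw [Int.mul_add_emod_self_left, Int.emod_eq_of_lt hr.1 hr.2]

theorem emod_mem_Ico (ht : 0 < t) (z : ℤ) : z % t ∈ Ico (0 : ℤ) t :=
  mem_Ico.2 ⟨Int.emod_nonneg _ (by omega), Int.emod_lt_of_pos _ (by omega)⟩

theorem card_Ico_zero (t : ℕ) : (Ico (0 : ℤ) t).card = t := by simp

theorem firstGaps_injOn (n : ℤ → ℤ) :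
    Set.InjOn (fun r => t * n r + r) (Ico (0 : ℤ) t : Set ℤ) := by
  intro r hr s hs h
  have := congrArg (· % (t : ℤ)) h
  simpa only [emod_of_mem_Ico (mem_coe.1 hr), emod_of_mem_Ico (mem_coe.1 hs)] using this

theorem card_firstGaps (n : ℤ → ℤ) : (firstGaps t n).card = t := by
  rw [firstGaps, card_image_of_injOn (firstGaps_injOn n), card_Ico_zero]

theorem sum_firstGaps (n : ℤ → ℤ) :
    ∑ z ∈ firstGaps t n, z = t * ∑ r ∈ Ico (0 : ℤ) t, n r + ∑ r ∈ Ico (0 : ℤ) t, r := by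
  rw [firstGaps, sum_image (firstGaps_injOn n), sum_add_distrib, mul_sum]

theorem image_emod_firstGaps (n : ℤ → ℤ) :
    (firstGaps t n).image (· % (t : ℤ)) = Ico (0 : ℤ) t := by
  rw [firstGaps, image_image]
  exact (image_congr fun r hr => emod_of_mem_Ico (mem_coe.1 hr) _).trans image_id

theorem firstGaps_emod_injOn (n : ℤ → ℤ) :
    Set.InjOn (· % (t : ℤ)) (firstGaps t n : Set ℤ) := by
  rw [← card_image_iff, image_emod_firstGaps, card_firstGaps, card_Ico_zero]

theorem firstGaps_inj {n n' : ℤ → ℤ} (h : firstGaps t n = firstGaps t n') :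
    ∀ r ∈ Ico (0 : ℤ) t, n r = n' r := by
  intro r hr
  have h1 : t * n r + r ∈ firstGaps t n' := h ▸ mem_image_of_mem _ hr
  obtain ⟨s, hs, hs'⟩ := mem_image.1 h1
  have h2 : s = r := by
    have := congrArg (· % (t : ℤ)) hs'
    simpa only [emod_of_mem_Ico hr, emod_of_mem_Ico hs] using this
  subst h2
  have := congrArg (· / (t : ℤ)) hs'
  simpa only [ediv_of_mem_Ico hr, eq_comm] using this

theorem exists_eq_firstGaps {Y : Finset ℤ} (hc : Y.card = t)
    (hY : Y.image (· % (t : ℤ)) = Ico (0 : ℤ) t) : ∃ n, Y = firstGaps t n := by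
  have hex : ∀ r ∈ Ico (0 : ℤ) t, ∃ y ∈ Y, y % t = r := by
    intro r hr
    rw [← hY] at hr
    exact mem_image.1 hr
  choose! y hy hyr using hex
  refine ⟨fun r => y r / t, (eq_of_subset_of_card_le ?_ ?_).symm⟩
  · intro z hz
    obtain ⟨r, hr, rfl⟩ := mem_image.1 hz
    have h1 := Int.mul_ediv_add_emod (y r) t
    rw [hyr r hr] at h1
    rw [h1]
    exact hy r hr
  · rw [card_firstGaps, hc]

theorem exists_bound (t : ℕ) (n : ℤ → ℤ) (K₀ : ℕ) :
    ∃ K : ℕ, K₀ ≤ K ∧ ∀ r ∈ Ico (0 : ℤ) t, -(K : ℤ) ≤ n r := by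
  refine ⟨K₀ + ∑ r ∈ Ico (0 : ℤ) t, (n r).natAbs, by omega, fun r hr => ?_⟩
  have := single_le_sum (f := fun r => (n r).natAbs) (fun _ _ => Nat.zero_le _) hr
  omega

/-- The numbers `t * k + r` with `-K ≤ k < n r` and `r = 0, …, t - 1`: when `n` is a charge vector,
the beads that are at least `-t * K`. -/
noncomputable def abacus (t K : ℕ) (n : ℤ → ℤ) : Finset ℤ :=
  ((Ico (0 : ℤ) t).sigma fun r => Ico (-(K : ℤ)) (n r)).image fun p => t * p.2 + p.1

theorem mem_abacus (ht : 0 < t) {K : ℕ} {n : ℤ → ℤ} {z : ℤ} :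
    z ∈ abacus t K n ↔ -((t * K : ℕ) : ℤ) ≤ z ∧ z / t < n (z % t) := by
  have ht' : (0 : ℤ) < t := by omega
  have hK : -((t * K : ℕ) : ℤ) ≤ z ↔ -(K : ℤ) ≤ z / t := by
    rw [Int.le_ediv_iff_mul_le ht']
    push_cast
    rw [neg_mul, mul_comm]
  rw [hK]
  simp only [abacus, mem_image, mem_sigma]
  constructor
  · rintro ⟨⟨r, k⟩, ⟨hr, hk⟩, rfl⟩
    simp only at hr hk ⊢
    rw [ediv_of_mem_Ico hr, emod_of_mem_Ico hr]
    exact mem_Ico.1 hk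
  · intro h
    exact ⟨⟨z % t, z / t⟩, ⟨emod_mem_Ico ht z, mem_Ico.2 h⟩, Int.mul_ediv_add_emod z t⟩

theorem abacus_injOn (K : ℕ) (n : ℤ → ℤ) :
    Set.InjOn (fun p : (_ : ℤ) × ℤ => t * p.2 + p.1)
      ((Ico (0 : ℤ) t).sigma fun r => Ico (-(K : ℤ)) (n r) : Finset _) := by
  rintro ⟨r, k⟩ h ⟨r', k'⟩ h' he
  simp only [coe_sigma, Set.mem_sigma_iff, mem_coe] at h h'
  have h1 := congrArg (· % (t : ℤ)) he
  have h2 := congrArg (· / (t : ℤ)) he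
  simp only [emod_of_mem_Ico h.1, emod_of_mem_Ico h'.1, ediv_of_mem_Ico h.1,
    ediv_of_mem_Ico h'.1] at h1 h2
  rw [h1, h2]

theorem card_abacus {K : ℕ} {n : ℤ → ℤ} (hK : ∀ r ∈ Ico (0 : ℤ) t, -(K : ℤ) ≤ n r) :
    ((abacus t K n).card : ℤ) = (t * K : ℕ) + ∑ r ∈ Ico (0 : ℤ) t, n r := by
  rw [abacus, card_image_of_injOn (abacus_injOn K n), card_sigma]
  push_cast
  have h1 : ∀ r ∈ Ico (0 : ℤ) t, ((Ico (-(K : ℤ)) (n r)).card : ℤ) = K + n r := by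
    intro r hr
    have := hK r hr
    rw [Int.card_Ico]
    omega
  rw [sum_congr rfl h1, sum_add_distrib, sum_const, card_Ico_zero, nsmul_eq_mul]

theorem IsCoreVector.topBeads_eq (ht : 0 < t) {l : YoungDiagram} {n : ℤ → ℤ}
    (h : IsCoreVector t l n) {K : ℕ} (hK : l.colLen 0 ≤ t * K) :
    topBeads l (t * K) = abacus t K n := by
  ext z
  rw [mem_topBeads hK, mem_abacus ht, h z]

theorem exists_rows_bound (ht : 0 < t) (l : YoungDiagram) (n : ℤ → ℤ) :
    ∃ K : ℕ, l.colLen 0 ≤ t * K ∧ ∀ r ∈ Ico (0 : ℤ) t, -(K : ℤ) ≤ n r := by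
  obtain ⟨K, h1, h2⟩ := exists_bound t n (l.colLen 0)
  exact ⟨K, h1.trans (Nat.le_mul_of_pos_left K ht), h2⟩

/-- The number of beads that are at least `-t * K` is `t * K`, the number of rows considered; counted
by residue classes it is `∑ r, (K + n r)`. -/
theorem IsCoreVector.sum_eq_zero (ht : 0 < t) {l : YoungDiagram} {n : ℤ → ℤ}
    (h : IsCoreVector t l n) : ∑ r ∈ Ico (0 : ℤ) t, n r = 0 := by
  obtain ⟨K, h1, h2⟩ := exists_rows_bound ht l n
  have h3 := card_abacus h2
  rw [← h.topBeads_eq ht h1, card_topBeads] at h3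
  omega

theorem IsCoreVector.eqOn {l : YoungDiagram} {n n' : ℤ → ℤ}
    (h : IsCoreVector t l n) (h' : IsCoreVector t l n') :
    ∀ r ∈ Ico (0 : ℤ) t, n r = n' r := by
  intro r hr
  refine eq_of_forall_lt_iff fun k => ?_
  have h1 := h (t * k + r)
  have h2 := h' (t * k + r)
  rw [ediv_of_mem_Ico hr, emod_of_mem_Ico hr] at h1 h2
  rw [← h1, h2]

theorem IsCoreVector.congr (ht : 0 < t) {l : YoungDiagram} {n n' : ℤ → ℤ}
    (h : IsCoreVector t l n) (hn : ∀ r ∈ Ico (0 : ℤ) t, n r = n' r) : IsCoreVector t l n' := by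
  intro z
  rw [h z, hn _ (emod_mem_Ico ht z)]

theorem IsCoreVector.unique {l m : YoungDiagram} {n : ℤ → ℤ}
    (h : IsCoreVector t l n) (h' : IsCoreVector t m n) : l = m :=
  beads_injective (Set.ext fun z => (h z).trans (h' z).symm)

theorem IsCoreVector.isCore (ht : 0 < t) {l : YoungDiagram} {n : ℤ → ℤ}
    (h : IsCoreVector t l n) : IsCore t l := by
  rintro ⟨i, j⟩ hc hdvd
  have ht' : (0 : ℤ) < t := by omega
  have hlt : gap l j < bead l i := gap_lt_bead_iff.2 ((YoungDiagram.mem_cells _).1 hc)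
  have h1 : (t : ℤ) ∣ bead l i - gap l j := by
    rw [← hookLength_eq hc]
    exact_mod_cast hdvd
  have h2 : bead l i % t = gap l j % t := 
    Int.emod_eq_emod_iff_emod_sub_eq_zero.2 (Int.emod_eq_zero_of_dvd h1)
  have h3 : bead l i / t < n (bead l i % t) := (h _).1 ⟨i, rfl⟩
  have h4 := mt (h _).2 (gap_notMem_beads l j)
  rw [h2] at h3
  have := Int.ediv_le_ediv ht' hlt.le
  omega

theorem exists_isCoreVector_of_sum_eq_zero (ht : 0 < t) {n : ℤ → ℤ}
    (hn : ∑ r ∈ Ico (0 : ℤ) t, n r = 0) : ∃ l, IsCoreVector t l n := by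
  have ht' : (0 : ℤ) < t := by omega
  obtain ⟨K, -, hK⟩ := exists_bound t n 0
  have h1 : (abacus t K n).card = t * K := by
    have := card_abacus hK
    omega
  obtain ⟨l, hl, hX⟩ := exists_topBeads_eq h1 (fun x hx => ((mem_abacus ht).1 hx).1)
  refine ⟨l, fun z => ?_⟩
  rw [mem_beads_iff hl, hX, mem_abacus ht]
  by_cases hz : z < -((t * K : ℕ) : ℤ)
  · have h2 := hK _ (emod_mem_Ico ht z)
    have h3 : z / t < -(K : ℤ) := by
      rw [Int.ediv_lt_iff_lt_mul ht']
      push_cast at hz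
      linarith
    exact iff_of_true (Or.inl hz) (by omega)
  · have h2 : -((t * K : ℕ) : ℤ) ≤ z := by omega
    simp only [hz, h2, false_or, true_and]

/-- If `z` were a bead and `z - t` a gap, they would determine a box of hook length `t`. -/
theorem IsCore.sub_mem_beads (ht : 0 < t) {l : YoungDiagram} (h : IsCore t l) {z : ℤ}
    (hz : z ∈ beads l) : z - t ∈ beads l := by
  by_contra hz'
  obtain ⟨i, rfl⟩ := hz
  obtain ⟨j, hj⟩ := exists_gap_of_notMem_beads hz'
  have hc : (i, j) ∈ l.cells := (YoungDiagram.mem_cells _).2 (gap_lt_bead_iff.1 (by omega))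
  have h1 := hookLength_eq hc
  refine h _ hc ?_
  have h2 : hookLength l (i, j) = t := by
    simp only at h1
    omega
  rw [h2]

theorem IsCore.exists_isCoreVector (ht : 0 < t) {l : YoungDiagram} (h : IsCore t l) :
    ∃ n, IsCoreVector t l n := by
  have ht' : (0 : ℤ) < t := by omega
  have hex : ∀ r ∈ Ico (0 : ℤ) t, ∃ N : ℤ, ∀ k : ℤ, t * k + r ∈ beads l ↔ k < N := by
    intro r hr
    have hr' := mem_Ico.1 hr
    have hdown : ∀ (d : ℕ) (k : ℤ), t * k + r ∈ beads l → t * (k - d) + r ∈ beads l := by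
      intro d
      induction d with
      | zero => intro k hk; simpa using hk
      | succ d ih =>
        intro k hk
        have h1 := h.sub_mem_beads ht (ih k hk)
        have h2 : (t : ℤ) * (k - (d + 1 : ℕ)) + r = t * (k - d) + r - t := by
          push_cast
          ring
        rwa [h2]
    have hlow : ∀ k : ℤ, t * k + r ∉ beads l → -(l.colLen 0 + 1 : ℤ) ≤ k := by
      intro k hk
      by_contra hlt
      refine hk (mem_beads_of_lt le_rfl ?_)
      nlinarith
    have hne : ∃ k : ℤ, t * k + r ∉ beads l := by
      -- The largest bead is `l.rowLen 0 - 1`.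
      refine ⟨l.rowLen 0, ?_⟩
      rintro ⟨i, hi⟩
      have h1 := (bead_strictAnti l).antitone (Nat.zero_le i)
      simp only [bead] at hi h1
      nlinarith
    obtain ⟨N, hN, hmin⟩ := Int.exists_least_of_bdd ⟨_, hlow⟩ hne
    refine ⟨N, fun k => ⟨fun hk => ?_, fun hk => ?_⟩⟩
    · by_contra hle
      refine hN ?_
      have := hdown (k - N).toNat k hk
      rwa [show k - ((k - N).toNat : ℤ) = N by omega] at this
    · by_contra hk'
      have := hmin k hk'
      omega
  choose! n hn using hex
  refine ⟨n, fun z => ?_⟩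
  rw [← hn _ (emod_mem_Ico ht z), Int.mul_ediv_add_emod]

/-! ### Residue partitions and the bijection -/

/-- Up to a common shift, the beads of the first `t` rows of `m` are the numbers `t * n r + r`. -/
def IsResidueVector (t : ℕ) (m : YoungDiagram) (n : ℤ → ℤ) : Prop :=
  ∃ c : ℤ, (topBeads m t).image (· + c) = firstGaps t n

theorem isResiduePartition_iff {m : YoungDiagram} :
    IsResiduePartition t m ↔
      m.colLen 0 ≤ t - 1 ∧ (topBeads m t).image (· % (t : ℤ)) = Ico (0 : ℤ) t := by
  rw [IsResiduePartition, YoungDiagram.length_rowLens, topBeads, image_image]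
  rfl

theorem image_add_emod {X : Finset ℤ} (hc : X.card = t)
    (hX : X.image (· % (t : ℤ)) = Ico (0 : ℤ) t) (ht : 0 < t) (c : ℤ) :
    (X.image (· + c)).image (· % (t : ℤ)) = Ico (0 : ℤ) t := by
  have hinj : Set.InjOn (· % (t : ℤ)) (X : Set ℤ) := by
    rw [← card_image_iff, hX, card_Ico_zero, hc]
  rw [image_image]
  refine eq_of_subset_of_card_le ?_ ?_
  · intro z hz
    obtain ⟨x, -, rfl⟩ := mem_image.1 hz
    exact emod_mem_Ico ht _
  · rw [card_image_of_injOn, card_Ico_zero, hc]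
    intro x hx y hy h
    exact hinj hx hy (Int.ModEq.add_right_cancel' c h)

theorem card_image_add (X : Finset ℤ) (c : ℤ) : (X.image (· + c)).card = X.card :=
  card_image_of_injective _ (add_left_injective c)

theorem sum_image_add (X : Finset ℤ) (c : ℤ) :
    ∑ z ∈ X.image (· + c), z = ∑ z ∈ X, z + X.card * c := by
  rw [sum_image (fun a _ b _ h => add_left_injective c h), sum_add_distrib, sum_const,
    nsmul_eq_mul]

/-- The shift that makes the charges sum to `0` is integral because the beads of the first `t` rows
represent every residue class once. -/
theorem IsResiduePartition.exists_isResidueVector (ht : 0 < t) {m : YoungDiagram}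
    (h : IsResiduePartition t m) :
    ∃ n, ∑ r ∈ Ico (0 : ℤ) t, n r = 0 ∧ IsResidueVector t m n := by
  have ht' : (0 : ℤ) < t := by omega
  rw [isResiduePartition_iff] at h
  have hc := card_topBeads m t
  have hsum : ∑ z ∈ topBeads m t, z =
      t * ∑ z ∈ topBeads m t, z / t + ∑ r ∈ Ico (0 : ℤ) t, r := by
    rw [← h.2, sum_image (card_image_iff.1 (by rw [h.2, card_Ico_zero, hc])), mul_sum,
      ← sum_add_distrib]
    exact sum_congr rfl fun z _ => (Int.mul_ediv_add_emod z t).symm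
  set c : ℤ := -∑ z ∈ topBeads m t, z / t with hcdef
  obtain ⟨n, hn⟩ := exists_eq_firstGaps ((card_image_add _ c).trans hc)
    (image_add_emod hc h.2 ht c)
  refine ⟨n, ?_, c, hn⟩
  have h1 := sum_image_add (topBeads m t) c
  rw [hn, sum_firstGaps, hsum, hc, hcdef] at h1
  have h2 : (t : ℤ) * ∑ r ∈ Ico (0 : ℤ) t, n r = 0 := by linarith
  exact (mul_eq_zero.1 h2).resolve_left ht'.ne'

/-- The condition on the sums fixes the shift. -/
theorem IsResidueVector.eqOn (ht : 0 < t) {m : YoungDiagram} {n n' : ℤ → ℤ}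
    (h : IsResidueVector t m n) (h' : IsResidueVector t m n')
    (hn : ∑ r ∈ Ico (0 : ℤ) t, n r = 0) (hn' : ∑ r ∈ Ico (0 : ℤ) t, n' r = 0) :
    ∀ r ∈ Ico (0 : ℤ) t, n r = n' r := by
  obtain ⟨c, hc⟩ := h
  obtain ⟨c', hc'⟩ := h'
  have h1 := sum_image_add (topBeads m t) c
  have h2 := sum_image_add (topBeads m t) c'
  rw [hc, sum_firstGaps, hn, card_topBeads] at h1
  rw [hc', sum_firstGaps, hn', card_topBeads] at h2
  have h3 : (t : ℤ) * c = t * c' := by linarith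
  have h4 : c = c' := mul_left_cancel₀ (by omega) h3
  subst h4
  exact firstGaps_inj (hc.symm.trans hc')

theorem IsResidueVector.congr {m : YoungDiagram} {n n' : ℤ → ℤ}
    (h : IsResidueVector t m n) (hn : ∀ r ∈ Ico (0 : ℤ) t, n r = n' r) :
    IsResidueVector t m n' := by
  obtain ⟨c, hc⟩ := h
  refine ⟨c, hc.trans (image_congr fun r hr => ?_)⟩
  simp only [hn r (mem_coe.1 hr)]

theorem neg_mem_topBeads (ht : 0 < t) {m : YoungDiagram} (hm : m.colLen 0 ≤ t - 1) :
    -(t : ℤ) ∈ topBeads m t := by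
  rw [topBeads, mem_image]
  refine ⟨t - 1, mem_range.2 (by omega), ?_⟩
  rw [bead, rowLen_eq_zero hm le_rfl]
  omega

/-- The shift is determined because the least bead of the first `t` rows is `-t` on both sides. -/
theorem IsResidueVector.unique (ht : 0 < t) {m m' : YoungDiagram} {n : ℤ → ℤ}
    (h : IsResidueVector t m n) (h' : IsResidueVector t m' n)
    (hm : m.colLen 0 ≤ t - 1) (hm' : m'.colLen 0 ≤ t - 1) : m = m' := by
  obtain ⟨c, hc⟩ := h
  obtain ⟨c', hc'⟩ := h'
  have key : ∀ {m m' : YoungDiagram} {c c' : ℤ}, m.colLen 0 ≤ t - 1 → m'.colLen 0 ≤ t - 1 →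
      (topBeads m t).image (· + c) = (topBeads m' t).image (· + c') → c' ≤ c := by
    intro m m' c c' hm hm' he
    have h1 : -(t : ℤ) + c ∈ (topBeads m' t).image (· + c') :=
      he ▸ mem_image_of_mem _ (neg_mem_topBeads ht hm)
    obtain ⟨x, hx, hx'⟩ := mem_image.1 h1
    have := ((mem_topBeads (by omega)).1 hx).1
    omega
  have he := hc.trans hc'.symm
  have h4 : c = c' := le_antisymm (key hm' hm he.symm) (key hm hm' he)
  subst h4
  have h5 := image_injective (add_left_injective c) he
  refine beads_injective (Set.ext fun z => ?_)
  rw [mem_beads_iff (n := t) (by omega), mem_beads_iff (n := t) (by omega), h5]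

theorem exists_isResiduePartition (ht : 0 < t) (n : ℤ → ℤ) :
    ∃ m, IsResiduePartition t m ∧ IsResidueVector t m n := by
  have hne : (firstGaps t n).Nonempty := by
    rw [← card_pos, card_firstGaps]
    exact ht
  -- The shift takes the least element of `firstGaps t n` to `-t`, the bead of an empty row `t - 1`.
  set c := (firstGaps t n).min' hne + t with hc
  have hcard : ((firstGaps t n).image (· + -c)).card = t :=
    (card_image_add _ _).trans (card_firstGaps n)
  obtain ⟨m, hm, hX⟩ := exists_topBeads_eq hcard (by
    intro x hx
    obtain ⟨z, hz, rfl⟩ := mem_image.1 hx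
    have := (firstGaps t n).min'_le z hz
    omega)
  refine ⟨m, isResiduePartition_iff.2 ⟨?_, ?_⟩, c, ?_⟩
  · have h1 : -(t : ℤ) ∈ topBeads m t := by
      rw [hX, mem_image]
      exact ⟨_, min'_mem _ hne, by omega⟩
    obtain ⟨i, hi, hi'⟩ := mem_image.1 h1
    rw [mem_range] at hi
    simp only [bead] at hi'
    refine colLen_zero_le ?_
    rw [show t - 1 = i by omega]
    omega
  · rw [hX]
    exact image_add_emod (card_firstGaps n) (image_emod_firstGaps n) ht _
  · rw [hX, image_image]
    refine (image_congr fun z _ => ?_).trans image_id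
    simp

/-- `l` and `m` come from the same charge vector: up to a common shift, the beads of the first `t`
rows of `m` are the least gaps of `l` in the residue classes modulo `t`. -/
def Corresponds (t : ℕ) (l m : YoungDiagram) : Prop :=
  ∃ n, IsCoreVector t l n ∧ IsResidueVector t m n

theorem exists_bijOn_corresponds (ht : 0 < t) :
    ∃ ψ : YoungDiagram → YoungDiagram,
      Set.BijOn ψ {l | IsCore t l} {m | IsResiduePartition t m} ∧
        ∀ l, IsCore t l → Corresponds t l (ψ l) := by
  have hex : ∀ l, IsCore t l → ∃ m, IsResiduePartition t m ∧ Corresponds t l m := by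
    intro l hl
    obtain ⟨n, hn⟩ := hl.exists_isCoreVector ht
    obtain ⟨m, hm, hmn⟩ := exists_isResiduePartition ht n
    exact ⟨m, hm, n, hn, hmn⟩
  choose! ψ hψ hcor using hex
  refine ⟨ψ, ⟨fun l hl => hψ l hl, ?_, ?_⟩, hcor⟩
  · intro l hl l' hl' he
    obtain ⟨n, hn, hm⟩ := hcor l hl
    obtain ⟨n', hn', hm'⟩ := hcor l' hl'
    rw [← he] at hm'
    exact (hn.congr ht
      (hm.eqOn ht hm' (hn.sum_eq_zero ht) (hn'.sum_eq_zero ht))).unique hn'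
  · intro m hm
    obtain ⟨n, hsum, hmn⟩ := IsResiduePartition.exists_isResidueVector ht hm
    obtain ⟨l, hl⟩ := exists_isCoreVector_of_sum_eq_zero ht hsum
    have hlc := hl.isCore ht
    refine ⟨l, hlc, ?_⟩
    obtain ⟨n', hn', hm'⟩ := hcor l hlc
    exact (hm'.congr (hn'.eqOn hl)).unique ht hmn (isResiduePartition_iff.1 (hψ l hlc)).1
      (isResiduePartition_iff.1 hm).1

/-! ### The hook lengths of a core -/

theorem mem_firstGaps (ht : 0 < t) {n : ℤ → ℤ} {z : ℤ} :
    z ∈ firstGaps t n ↔ z / t = n (z % t) := by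
  rw [firstGaps, mem_image]
  constructor
  · rintro ⟨r, hr, rfl⟩
    rw [ediv_of_mem_Ico hr, emod_of_mem_Ico hr]
  · intro h
    exact ⟨z % t, emod_mem_Ico ht z, by rw [← h, Int.mul_ediv_add_emod]⟩

theorem not_dvd_sub_of_mem_firstGaps {n : ℤ → ℤ} {v w : ℤ} (hv : v ∈ firstGaps t n)
    (hw : w ∈ firstGaps t n) (hvw : v ≠ w) : ¬ (t : ℤ) ∣ v - w := fun h =>
  hvw (firstGaps_emod_injOn n hv hw
    (Int.emod_eq_emod_iff_emod_sub_eq_zero.2 (Int.emod_eq_zero_of_dvd h)))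

/-- The hook lengths of a core in terms of its least gaps `v`, `w` in the residue classes: each
pair contributes the positive numbers `v - w - t * k`, `k ≥ 1`, with multiplicity `k`, since a bead
in the class of `v` is `v - t * (a + 1)` and a gap in the class of `w` is `w + t * j`. -/
theorem prod_hookLength_core {M : Type*} [CommMonoid M] (ht : 0 < t) {l : YoungDiagram}
    {n : ℤ → ℤ} (h : IsCoreVector t l n) (f : ℤ → M) :
    ∏ c ∈ l.cells, f (hookLength l c) =
      ∏ v ∈ firstGaps t n, ∏ w ∈ firstGaps t n,
        ∏ k ∈ range ((v - w) / t).toNat, f (v - w - t * (k + 1)) ^ (k + 1) := by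
  have ht' : (0 : ℤ) < t := by omega
  have ht0 : (t : ℤ) ≠ 0 := ht'.ne'
  obtain ⟨K, h1, h2⟩ := exists_rows_bound ht l n
  have hdiag : ∀ v w : ℤ, ∀ q : ℕ,
      ∏ k ∈ range q, f (v - w - t * (k + 1)) ^ (k + 1) =
        ∏ a ∈ range q, ∏ j ∈ range (q - a), f (v - w - t * ((a + j : ℕ) + 1)) := by
    intro v w q
    rw [← prod_range_diag_flip q (fun a j => f (v - w - t * ((a + j : ℕ) + 1)))]
    refine prod_congr rfl fun k _ => ?_
    rw [← card_range (k + 1), ← prod_const, card_range]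
    refine prod_congr rfl fun i hi => ?_
    rw [mem_range] at hi
    rw [show i + (k - i) = k by omega]
  simp only [hdiag]
  rw [prod_hookLength h1, h.topBeads_eq ht h1, ← prod_product', prod_sigma']
  simp only [prod_sigma']
  refine (prod_bij (fun p _ => ⟨p.1.1 - t * (p.2.1 + 1), p.1.2 + t * p.2.2⟩) ?_ ?_ ?_ ?_).symm
  · rintro ⟨⟨v, w⟩, ⟨a, j⟩⟩ hp
    simp only [mem_sigma, mem_product, mem_range] at hp
    obtain ⟨⟨hv, hw⟩, ha, hj⟩ := hp
    have hv' := (mem_firstGaps ht).1 hv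
    have hw' := (mem_firstGaps ht).1 hw
    have hle : (t : ℤ) * (a + j + 1) ≤ v - w := by
      have : (a + j + 1 : ℤ) ≤ (v - w) / t := by omega
      have := (Int.le_ediv_iff_mul_le ht').1 this
      linarith
    have hne : (t : ℤ) * (a + j + 1) ≠ v - w := by
      intro he
      have hvw : v ≠ w := by
        rintro rfl
        have h3 : (0 : ℤ) < t * (a + j + 1) := by positivity
        omega
      exact not_dvd_sub_of_mem_firstGaps hv hw hvw ⟨_, he.symm⟩
    have hwK : -((t * K : ℕ) : ℤ) ≤ w := by
      have h3 := h2 _ (emod_mem_Ico ht w)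
      rw [← hw', Int.le_ediv_iff_mul_le ht'] at h3
      push_cast
      linarith
    have hjt : (0 : ℤ) ≤ t * j := by positivity
    have hlt : w + t * j < v - t * (a + 1) := by
      have := lt_of_le_of_ne hle hne
      linarith
    simp only [mem_sigma, mem_sdiff, mem_Ico, mem_abacus ht, not_and, not_lt]
    refine ⟨⟨by omega, ?_⟩, ⟨by omega, hlt⟩, fun _ => ?_⟩
    · rw [Int.sub_mul_ediv_left _ _ ht0, Int.sub_mul_emod_self_left, hv']
      omega
    · rw [Int.add_mul_ediv_left _ _ ht0, Int.add_mul_emod_self_left, hw']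
      omega
  · rintro ⟨⟨v, w⟩, ⟨a, j⟩⟩ hp ⟨⟨v', w'⟩, ⟨a', j'⟩⟩ hp' he
    simp only [mem_sigma, mem_product, mem_range] at hp hp'
    simp only [Sigma.mk.injEq, heq_eq_eq] at he
    have hv : v = v' := firstGaps_emod_injOn n hp.1.1 hp'.1.1 (by
      have := congrArg (· % (t : ℤ)) he.1
      simpa only [Int.sub_mul_emod_self_left] using this)
    have hw : w = w' := firstGaps_emod_injOn n hp.1.2 hp'.1.2 (by
      have := congrArg (· % (t : ℤ)) he.2
      simpa only [Int.add_mul_emod_self_left] using this)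
    subst hv hw
    have ha : (a : ℤ) + 1 = a' + 1 := mul_left_cancel₀ ht0 (by linarith [he.1])
    have hj : (j : ℤ) = j' := mul_left_cancel₀ ht0 (by linarith [he.2])
    obtain rfl : a = a' := by omega
    obtain rfl : j = j' := by omega
    rfl
  · rintro ⟨x, z⟩ hp
    simp only [mem_sigma, mem_sdiff, mem_Ico, mem_abacus ht, not_and, not_lt] at hp
    obtain ⟨⟨hxK, hx⟩, ⟨hzK, hzx⟩, hz⟩ := hp
    have hz' := hz hzK
    set a : ℕ := (n (x % t) - 1 - x / t).toNat with ha
    set j : ℕ := (z / t - n (z % t)).toNat with hj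
    have ha' : (a : ℤ) + 1 = n (x % t) - x / t := by omega
    have hj' : (j : ℤ) = z / t - n (z % t) := by omega
    have hxe := Int.mul_ediv_add_emod x t
    have hze := Int.mul_ediv_add_emod z t
    have hq : (a : ℤ) + j + 1 ≤
        (t * n (x % t) + x % t - (t * n (z % t) + z % t)) / t := by
      rw [Int.le_ediv_iff_mul_le ht']
      have : (a : ℤ) + j + 1 = n (x % t) - x / t + (z / t - n (z % t)) := by omega
      rw [this]
      nlinarith
    refine ⟨⟨(t * n (x % t) + x % t, t * n (z % t) + z % t), ⟨a, j⟩⟩, ?_, ?_⟩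
    · simp only [mem_sigma, mem_product, mem_range]
      refine ⟨⟨mem_image_of_mem _ (emod_mem_Ico ht x), mem_image_of_mem _ (emod_mem_Ico ht z)⟩,
        ?_, ?_⟩ <;> omega
    · simp only [ha', hj', Sigma.mk.injEq, heq_eq_eq]
      constructor <;> linarith
  · rintro ⟨⟨v, w⟩, ⟨a, j⟩⟩ _
    simp only
    congr 1
    push_cast
    ring

/-- A product over ordered pairs, trivial on the diagonal, as a product over unordered pairs. -/
@[to_additive]
theorem prod_eq_prod_lt {M : Type*} [CommMonoid M] (V : Finset ℤ) (H : ℤ → ℤ → M)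
    (h0 : ∀ v ∈ V, H v v = 1) :
    ∏ v ∈ V, ∏ w ∈ V, H v w = ∏ v ∈ V, ∏ w ∈ V with w < v, H v w * H w v := by
  have h1 : ∀ v ∈ V, ∏ w ∈ V, H v w =
      (∏ w ∈ V with w < v, H v w) * ∏ w ∈ V with v < w, H v w := by
    intro v hv
    rw [← prod_filter_mul_prod_filter_not V (fun w => w < v)]
    congr 1
    refine (prod_subset ?_ ?_).symm
    · intro w hw
      simp only [mem_filter, not_lt] at hw ⊢
      exact ⟨hw.1, hw.2.le⟩
    · intro w hw hw'
      simp only [mem_filter, not_lt, not_and] at hw hw'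
      rw [le_antisymm (hw' hw.1) hw.2, h0 _ hv]
  rw [prod_congr rfl h1, prod_mul_distrib]
  simp only [prod_mul_distrib]
  congr 1
  refine prod_comm' ?_
  intro v w
  simp only [mem_filter]
  tauto

/-- The exponent of `g m` on the left is `(m - 1) + (m + 1) - 2 * m = 0` for `0 < m < q`. -/
theorem prod_ratio_telescope {F : Type*} [Field F] (g : ℕ → F) (q : ℕ)
    (hg : ∀ k ∈ range q, g (k + 1) ≠ 0) :
    (∏ k ∈ range q, (g (k + 2) * g k / g (k + 1) ^ 2) ^ (k + 1)) * g q ^ (q + 1) =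
      g 0 * g (q + 1) ^ q := by
  induction q with
  | zero => simp
  | succ q ih =>
    have h1 := ih fun k hk => hg k (by simp only [mem_range] at hk ⊢; omega)
    have h2 : g (q + 1) ≠ 0 := hg q (by simp)
    rw [prod_range_succ, div_pow, mul_pow]
    have h3 : g (q + 1) ^ (q + 1 + 1) * g (q + 1) ^ q = (g (q + 1) ^ 2) ^ (q + 1) := by ring
    have h4 : g (q + 1) ^ q ≠ 0 := pow_ne_zero _ h2
    rw [← h3]
    field_simp
    linear_combination g (q + 1 + 1) ^ (q + 1) * h1

/-! ### The product formula -/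

theorem prod_int_range {M : Type*} [CommMonoid M] (f : ℤ → M) :
    ∏ r ∈ Ico (0 : ℤ) t, f r = ∏ i ∈ range t, f i := by
  refine (prod_bij (fun (i : ℕ) _ => (i : ℤ)) ?_ ?_ ?_ ?_).symm
  · intro i hi
    rw [mem_range] at hi
    rw [mem_Ico]
    omega
  · intro i _ j _ h
    exact_mod_cast h
  · intro r hr
    rw [mem_Ico] at hr
    exact ⟨r.toNat, mem_range.2 (by omega), by omega⟩
  · intros
    rfl

@[to_additive]
theorem prod_Ico_sub {M : Type*} [CommMonoid M] (f : ℤ → M) (a b : ℤ) :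
    ∏ z ∈ Ico a b, f (b - z) = ∏ k ∈ range (b - a).toNat, f (k + 1) := by
  refine (prod_bij (fun (k : ℕ) _ => b - (k + 1)) ?_ ?_ ?_ ?_).symm
  · intro i hi
    rw [mem_range] at hi
    rw [mem_Ico]
    omega
  · intro i _ j _ h
    omega
  · intro r hr
    rw [mem_Ico] at hr
    exact ⟨(b - r - 1).toNat, mem_range.2 (by omega), by omega⟩
  · intro k _
    congr 1
    ring

theorem prod_periodic_sub {M : Type*} [CommMonoid M] (ht : 0 < t) {T : ℤ → M}
    (hT : ∀ z, T (z % t) = T z) (r : ℤ) :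
    ∏ s ∈ Ico (0 : ℤ) t, T (r - s) = ∏ s ∈ Ico (0 : ℤ) t, T s := by
  refine prod_nbij' (fun s => (r - s) % t) (fun s => (r - s) % t) ?_ ?_ ?_ ?_ ?_
  · intro s _
    exact emod_mem_Ico ht _
  · intro s _
    exact emod_mem_Ico ht _
  · intro s hs
    rw [mem_Ico] at hs
    rw [Int.sub_emod_emod, sub_sub_cancel, Int.emod_eq_of_lt hs.1 hs.2]
  · intro s hs
    rw [mem_Ico] at hs
    rw [Int.sub_emod_emod, sub_sub_cancel, Int.emod_eq_of_lt hs.1 hs.2]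
  · intro s _
    exact (hT _).symm

theorem prod_periodic_add {M : Type*} [CommMonoid M] (ht : 0 < t) {T : ℤ → M}
    (hT : ∀ z, T (z % t) = T z) (s : ℤ) :
    ∏ r ∈ Ico (0 : ℤ) t, T (r - s) = ∏ r ∈ Ico (0 : ℤ) t, T r := by
  refine prod_nbij' (fun r => (r - s) % t) (fun r => (r + s) % t) ?_ ?_ ?_ ?_ ?_
  · intro s _
    exact emod_mem_Ico ht _
  · intro s _
    exact emod_mem_Ico ht _
  · intro r hr
    rw [mem_Ico] at hr
    rw [Int.emod_add_emod, sub_add_cancel, Int.emod_eq_of_lt hr.1 hr.2]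
  · intro r hr
    rw [mem_Ico] at hr
    rw [Int.emod_sub_emod, add_sub_cancel_right, Int.emod_eq_of_lt hr.1 hr.2]
  · intro s _
    exact (hT _).symm

theorem prod_zpow_eq_zpow_sum {G : Type*} [CommGroup G] (a : G) (s : Finset ℤ) (f : ℤ → ℤ) :
    ∏ i ∈ s, a ^ f i = a ^ ∑ i ∈ s, f i := by
  induction s using Finset.cons_induction with
  | empty => simp
  | cons i s hi ih => rw [prod_cons, sum_cons, zpow_add, ih]

/-- For a function of period `t`, the contribution of the charges cancels: the exponent is
`n r - n s + ((r - s) / t + 1)`, the product of `T (r - s)` over `s` does not depend on `r`, and the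
charges sum to `0`. What remains is the value for the zero vector. -/
theorem prod_periodic_firstGaps {G : Type*} [CommGroup G] (ht : 0 < t) {T : ℤ → G}
    (hT : ∀ z, T (z % t) = T z) (hT0 : T 0 = 1) {n : ℤ → ℤ}
    (hn : ∑ r ∈ Ico (0 : ℤ) t, n r = 0) :
    ∏ v ∈ firstGaps t n, ∏ w ∈ firstGaps t n, T (v - w) ^ ((v - w) / t + 1) =
      ∏ i ∈ range t, ∏ k ∈ range i, T (k + 1) := by
  have ht0 : (t : ℤ) ≠ 0 := by omega
  have hT' : ∀ z k : ℤ, T (t * k + z) = T z := by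
    intro z k
    rw [← hT, Int.mul_add_emod_self_left, hT]
  simp only [firstGaps, prod_image (firstGaps_injOn n)]
  have hterm : ∀ r s : ℤ, T (t * n r + r - (t * n s + s)) ^ ((t * n r + r - (t * n s + s)) / t + 1)
      = T (r - s) ^ n r * (T (r - s) ^ n s)⁻¹ * T (r - s) ^ ((r - s) / t + 1) := by
    intro r s
    have h1 : t * n r + r - (t * n s + s) = t * (n r - n s) + (r - s) := by ring
    rw [h1, hT', Int.mul_add_ediv_left _ _ ht0, add_assoc, zpow_add, zpow_sub]
  simp only [hterm, prod_mul_distrib, prod_inv_distrib]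
  have h1 : ∏ r ∈ Ico (0 : ℤ) t, ∏ s ∈ Ico (0 : ℤ) t, T (r - s) ^ n r = 1 := by
    simp only [prod_zpow, prod_periodic_sub ht hT]
    rw [prod_zpow_eq_zpow_sum, hn, zpow_zero]
  have h2 : ∏ r ∈ Ico (0 : ℤ) t, ∏ s ∈ Ico (0 : ℤ) t, T (r - s) ^ n s = 1 := by
    rw [prod_comm]
    simp only [prod_zpow, prod_periodic_add ht hT]
    rw [prod_zpow_eq_zpow_sum, hn, zpow_zero]
  rw [h1, h2, inv_one, one_mul, one_mul, prod_int_range]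
  refine prod_congr rfl fun i hi => ?_
  rw [mem_range] at hi
  have h3 : ∀ s ∈ Ico (0 : ℤ) t, T (i - s) ^ ((i - s) / t + 1) =
      if s < i then T (i - s) else 1 := by
    intro s hs
    rw [mem_Ico] at hs
    rcases lt_trichotomy s i with h | h | h
    · rw [if_pos h, Int.ediv_eq_zero_of_lt (by omega) (by omega), zero_add, zpow_one]
    · rw [if_neg h.not_lt, h, sub_self, hT0, one_zpow]
    · have : ((i : ℤ) - s) / t = -1 := by
        rw [show (i : ℤ) - s = t * (-1) + (i - s + t) by ring, Int.mul_add_ediv_left _ _ ht0,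
          Int.ediv_eq_zero_of_lt (by omega) (by omega), add_zero]
      rw [if_neg (by omega), this, neg_add_cancel, zpow_zero]
  rw [prod_congr rfl h3, ← prod_filter]
  have h5 : (Ico (0 : ℤ) t).filter (fun s : ℤ => s < (i : ℤ)) = Ico 0 (i : ℤ) := by
    ext s
    simp only [mem_filter, mem_Ico]
    omega
  rw [h5, prod_Ico_sub T 0 i]
  simp

theorem ediv_nonneg_of_lt (ht : 0 < t) {v w : ℤ} (h : w < v) :
    (((v - w) / t).toNat : ℤ) = (v - w) / t :=
  Int.toNat_of_nonneg (Int.ediv_nonneg (by omega) (by omega))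

theorem emod_mem_Ioo {n : ℤ → ℤ} (ht : 0 < t) {v w : ℤ} (hv : v ∈ firstGaps t n)
    (hw : w ∈ firstGaps t n) (h : w < v) : (v - w) % t ∈ Ioo (0 : ℤ) t := by
  have h1 := mem_Ico.1 (emod_mem_Ico ht (v - w))
  have h2 : (v - w) % t ≠ 0 := fun h0 =>
    not_dvd_sub_of_mem_firstGaps hv hw h.ne' (Int.dvd_of_emod_eq_zero h0)
  rw [mem_Ioo]
  omega

theorem neg_emod_ediv {d : ℤ} (hd : d % t ∈ Ioo (0 : ℤ) t) :
    (-d) % t = t - d % t ∧ (-d) / t = -(d / t) - 1 := by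
  have hd' := mem_Ioo.1 hd
  have hr : (t : ℤ) - d % t ∈ Ico (0 : ℤ) t := mem_Ico.2 (by omega)
  have h1 := Int.mul_ediv_add_emod d t
  have h2 : -d = t * (-(d / t) - 1) + (t - d % t) := by linarith
  have h3 := emod_of_mem_Ico hr (-(d / t) - 1)
  have h4 := ediv_of_mem_Ico hr (-(d / t) - 1)
  rw [← h2] at h3 h4
  exact ⟨h3, h4⟩

/-- In terms of ordered pairs, the factor `τ (t - ρ)` to the power `-q` belongs to the pair `(w, v)`,
for which `(w - v) % t = t - ρ` and `(w - v) / t + 1 = -q`, where `ρ = (v - w) % t` and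
`q = (v - w) / t`. This reduces the claim to `prod_periodic_firstGaps`. -/
theorem prod_residue_powers {F : Type*} [Field F] (ht : 0 < t) {τ : ℤ → F}
    (hτ : ∀ z ∈ Ioo (0 : ℤ) t, τ z ≠ 0) {n : ℤ → ℤ} (hn : ∑ r ∈ Ico (0 : ℤ) t, n r = 0) :
    ∏ v ∈ firstGaps t n, ∏ w ∈ firstGaps t n with w < v,
        τ ((v - w) % t) ^ (((v - w) / t).toNat + 1) / τ (t - (v - w) % t) ^ ((v - w) / t).toNat =
      ∏ i ∈ range t, ∏ k ∈ range i, τ (k + 1) := by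
  classical
  -- `T` is periodic, and agrees with `τ` on `1, …, t - 1`; its value `1` on multiples of `t` makes
  -- the diagonal pairs trivial.
  let U : ℤ → Fˣ := fun z => if h : τ z ≠ 0 ∧ z ≠ 0 then Units.mk0 (τ z) h.1 else 1
  let T : ℤ → Fˣ := fun z => U (z % t)
  have hTval : ∀ z : ℤ, z % t ∈ Ioo (0 : ℤ) t → (T z : F) = τ (z % t) := by
    intro z hz
    have h1 := hτ _ hz
    have h2 : z % t ≠ 0 := (mem_Ioo.1 hz).1.ne'
    simp only [T, U, dif_pos (And.intro h1 h2), Units.val_mk0]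
  have h := prod_periodic_firstGaps ht (T := T) (by intro z; simp only [T, Int.emod_emod])
    (by simp [T, U]) hn
  rw [prod_eq_prod_lt _ _ (by intro v _; simp [T, U])] at h
  have h' := congrArg (Units.val) h
  simp only [Units.coe_prod, Units.val_mul] at h'
  refine (prod_congr rfl fun v hv => prod_congr rfl fun w hw => ?_).trans
    (h'.trans (prod_congr rfl fun i hi => prod_congr rfl fun k hk => ?_))
  · obtain ⟨hw, hlt⟩ := mem_filter.1 hw
    have h1 := emod_mem_Ioo ht hv hw hlt
    obtain ⟨h2, h3⟩ := neg_emod_ediv h1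
    have h4 : (w - v) % t ∈ Ioo (0 : ℤ) t := by
      rw [← neg_sub, h2]
      rw [mem_Ioo] at h1 ⊢
      omega
    rw [Units.val_zpow_eq_zpow_val, Units.val_zpow_eq_zpow_val, hTval _ h1, hTval _ h4,
      ← neg_sub v w, h2, h3, sub_add_cancel, zpow_neg, ← ediv_nonneg_of_lt ht hlt, zpow_natCast,
      ← div_eq_mul_inv, ← zpow_natCast _ (_ + 1)]
    push_cast
    rfl
  · rw [mem_range] at hi hk
    have h1 : ((k : ℤ) + 1) % t = k + 1 := Int.emod_eq_of_lt (by omega) (by omega)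
    rw [hTval _ (by rw [h1, mem_Ioo]; omega), h1]

theorem prod_filter_lt_eq {M : Type*} [CommMonoid M] {V : Finset ℤ} {f : ℤ → ℤ → ℕ → M}
    (ht : 0 < t) :
    ∏ v ∈ V, ∏ w ∈ V, ∏ k ∈ range ((v - w) / t).toNat, f v w k =
      ∏ v ∈ V, ∏ w ∈ V with w < v, ∏ k ∈ range ((v - w) / t).toNat, f v w k := by
  refine prod_congr rfl fun v _ => (prod_subset (filter_subset _ _) ?_).symm
  intro w hw hw'
  have h1 : ¬ w < v := fun h => hw' (mem_filter.2 ⟨hw, h⟩)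
  have h2 : (v - w) / t ≤ 0 := Int.ediv_nonpos_of_nonpos_of_neg (by omega) (by omega)
  rw [Int.toNat_of_nonpos h2, range_zero, prod_empty]

/-- For each pair of least gaps the product of the ratios telescopes. -/
theorem prod_hook_ratio {F : Type*} [Field F] (ht : 0 < t) {τ : ℤ → F} {l : YoungDiagram}
    {n : ℤ → ℤ} (h : IsCoreVector t l n) (hl : ∀ c ∈ l.cells, τ (hookLength l c) ≠ 0)
    (hτ : ∀ z ∈ Ioo (0 : ℤ) t, τ z ≠ 0) :
    ∏ c ∈ l.cells, τ ((hookLength l c : ℤ) - t) * τ ((hookLength l c : ℤ) + t) /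
        τ (hookLength l c) ^ 2 =
      ∏ v ∈ firstGaps t n, ∏ w ∈ firstGaps t n with w < v,
        τ (v - w) * τ ((v - w) % t - t) ^ ((v - w) / t).toNat /
          τ ((v - w) % t) ^ (((v - w) / t).toNat + 1) := by
  rw [prod_hookLength_core ht h (fun z => τ (z - t) * τ (z + t) / τ z ^ 2), prod_filter_lt_eq ht]
  have hne : ∏ c ∈ l.cells, τ (hookLength l c) ≠ 0 := prod_ne_zero_iff.2 hl
  rw [prod_hookLength_core ht h τ] at hne
  refine prod_congr rfl fun v hv => prod_congr rfl fun w hw => ?_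
  obtain ⟨hw, hlt⟩ := mem_filter.1 hw
  have h1 := hτ _ (emod_mem_Ioo ht hv hw hlt)
  set q := ((v - w) / t).toNat with hq
  have hq' : (q : ℤ) = (v - w) / t := ediv_nonneg_of_lt ht hlt
  have hρ : (v - w) % t = v - w - t * q := by
    have := Int.mul_ediv_add_emod (v - w) t
    rw [hq']
    linarith
  rw [eq_div_iff (pow_ne_zero _ h1)]
  have key := prod_ratio_telescope (fun k : ℕ => τ (v - w - t * k)) q (by
    intro k hk
    have h2 := prod_ne_zero_iff.1 (prod_ne_zero_iff.1 (prod_ne_zero_iff.1 hne v hv) w hw) k hk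
    push_cast
    exact ne_zero_pow (Nat.succ_ne_zero k) h2)
  simp only [Nat.cast_zero, mul_zero, sub_zero] at key
  rw [hρ]
  convert key using 2
  · refine prod_congr rfl fun k _ => ?_
    rw [show v - w - t * ((k : ℤ) + 1) - t = v - w - t * ((k + 2 : ℕ) : ℤ) by push_cast; ring,
      show v - w - t * ((k : ℤ) + 1) + t = v - w - t * (k : ℤ) by ring, ← Nat.cast_succ k]
  · congr 2
    push_cast
    ring

/-- The hook lengths below `t` of a core are the remainders `(v - w) % t`, each with multiplicity
`(v - w) / t`. -/
theorem prod_pow_beta {M : Type*} [CommMonoid M] (ht : 0 < t) {l : YoungDiagram}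
    {n : ℤ → ℤ} (h : IsCoreVector t l n) (G : ℤ → M) :
    ∏ i ∈ Icc 1 (t - 1), G i ^ beta t l i =
      ∏ v ∈ firstGaps t n, ∏ w ∈ firstGaps t n with w < v,
        G (t - (v - w) % t) ^ ((v - w) / t).toNat := by
  have ht' : (0 : ℤ) < t := by omega
  have h1 : ∏ i ∈ Icc 1 (t - 1), G i ^ beta t l i =
      ∏ c ∈ l.cells, (fun z : ℤ => if z < t then G (t - z) else 1) (hookLength l c) := by
    have h2 : ∀ i : ℕ, G i ^ beta t l i =
        ∏ c ∈ l.cells, if hookLength l c + i = t then G i else 1 := by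
      intro i
      rw [beta, prod_ite, prod_const_one, mul_one, prod_const]
    rw [prod_congr rfl fun i _ => h2 i, prod_comm]
    refine prod_congr rfl fun c _ => ?_
    have hpos : 0 < hookLength l c := Nat.succ_pos _
    by_cases hc : hookLength l c < t
    · rw [prod_eq_single (t - hookLength l c)]
      · rw [if_pos (by omega)]
        simp only
        rw [if_pos (by omega)]
        congr 1
        omega
      · intro i hi hne
        rw [if_neg (by omega)]
      · intro hn
        rw [mem_Icc] at hn
        omega
    · simp only
      rw [if_neg (by omega)]
      refine prod_eq_one fun i hi => ?_
      rw [mem_Icc] at hi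
      rw [if_neg (by omega)]
  rw [h1, prod_hookLength_core ht h (fun z : ℤ => if z < t then G (t - z) else 1),
    prod_filter_lt_eq ht]
  refine prod_congr rfl fun v hv => prod_congr rfl fun w hw => ?_
  obtain ⟨hw, hlt⟩ := mem_filter.1 hw
  have h1 := mem_Ioo.1 (emod_mem_Ioo ht hv hw hlt)
  set q := ((v - w) / t).toNat with hq
  have hq' : (q : ℤ) = (v - w) / t := ediv_nonneg_of_lt ht hlt
  have hρ : (v - w) % t = v - w - t * q := by
    have := Int.mul_ediv_add_emod (v - w) t
    rw [hq']
    linarith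
  rcases Nat.eq_zero_or_pos q with h0 | h0
  · rw [h0, range_zero, prod_empty, pow_zero]
  obtain ⟨p, hp⟩ : ∃ p, q = p + 1 := ⟨q - 1, by omega⟩
  rw [hp, prod_range_succ, prod_eq_one, one_mul]
  · have : v - w - t * ((p : ℤ) + 1) = (v - w) % t := by
      rw [hρ, hp]
      push_cast
      ring
    rw [this, if_pos h1.2]
  · intro k hk
    rw [mem_range] at hk
    rw [if_neg, one_pow]
    have h3 : (t : ℤ) * (k + 1 + 1) ≤ t * q := mul_le_mul_of_nonneg_left (by omega) ht'.le
    have h4 : (t : ℤ) * (k + 1 + 1) = t * (k + 1) + t := by ring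
    omega

/-- A form of `Finset.prod_range_reflect` whose proof `to_additive` can translate. -/
@[to_additive]
theorem prod_range_reversed {M : Type*} [CommMonoid M] (f : ℕ → M) (n : ℕ) :
    ∏ i ∈ range n, f (n - 1 - i) = ∏ i ∈ range n, f i := by
  refine prod_nbij' (fun i => n - 1 - i) (fun i => n - 1 - i) ?_ ?_ ?_ ?_ fun _ _ => rfl <;>
  · intro i hi
    simp only [mem_range] at hi ⊢
    omega

/-- In row `i`, with bead `x`, the hook lengths and the differences `x - y` to the lower beads of the
first `t` rows are together `1, …, x + t`, and so are `1, …, t - 1 - i` and the numbers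
`t + content c`. -/
@[to_additive]
theorem prod_hook_mul_prod_sub {M : Type*} [CommMonoid M] {m : YoungDiagram}
    (hm : m.colLen 0 ≤ t) (τ : ℤ → M) :
    (∏ c ∈ m.cells, τ (hookLength m c)) *
        ∏ x ∈ topBeads m t, ∏ y ∈ topBeads m t with y < x, τ (x - y) =
      (∏ c ∈ m.cells, τ (t + content c)) * ∏ i ∈ range t, ∏ k ∈ range i, τ (k + 1) := by
  have h1 : ∏ x ∈ topBeads m t, ((∏ z ∈ Ico (-(t : ℤ)) x \ topBeads m t, τ (x - z)) *
      ∏ y ∈ topBeads m t with y < x, τ (x - y)) =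
      ∏ x ∈ topBeads m t, ∏ z ∈ Ico (-(t : ℤ)) x, τ (x - z) := by
    refine prod_congr rfl fun x _ => ?_
    have h2 : (topBeads m t).filter (fun y => y < x) = Ico (-(t : ℤ)) x ∩ topBeads m t := by
      ext y
      simp only [mem_filter, mem_inter, mem_Ico, mem_topBeads hm]
      tauto
    rw [h2, mul_comm]
    exact prod_inter_mul_prod_sdiff _ _ _
  rw [prod_hookLength hm, ← prod_mul_distrib, h1, prod_topBeads, prod_cells hm,
    ← prod_range_reversed (fun i => ∏ k ∈ range i, τ (k + 1)), ← prod_mul_distrib]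
  refine prod_congr rfl fun i hi => ?_
  rw [mem_range] at hi
  rw [prod_Ico_sub, show (bead m i - -(t : ℤ)).toNat = (t - 1 - i) + m.rowLen i by
    simp only [bead]; omega, prod_range_add, mul_comm]
  congr 1
  refine prod_congr rfl fun j _ => ?_
  congr 1
  simp only [content]
  omega

theorem prod_image_add_lt {M : Type*} [CommMonoid M] (X : Finset ℤ) (c : ℤ) (f : ℤ → M) :
    ∏ v ∈ X.image (· + c), ∏ w ∈ X.image (· + c) with w < v, f (v - w) =
      ∏ x ∈ X, ∏ y ∈ X with y < x, f (x - y) := by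
  have hinj := add_left_injective c
  simp only [prod_filter]
  rw [prod_image fun a _ b _ h => hinj h]
  refine prod_congr rfl fun x _ => ?_
  rw [prod_image fun a _ b _ h => hinj h]
  refine prod_congr rfl fun y _ => ?_
  simp

/-- The product formula for a core and the corresponding residue partition. -/
theorem Corresponds.prod_eq {F : Type*} [Field F] (ht : 0 < t) {l m : YoungDiagram}
    (h : Corresponds t l m) (hm : m.colLen 0 ≤ t) {τ : ℤ → F}
    (hl : ∀ c ∈ l.cells, τ (hookLength l c) ≠ 0) (hτ : ∀ z ∈ Ioo (0 : ℤ) t, τ z ≠ 0)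
    (hmh : ∀ c ∈ m.cells, τ (hookLength m c) ≠ 0) :
    ∏ c ∈ l.cells, τ ((hookLength l c : ℤ) - t) * τ ((hookLength l c : ℤ) + t) /
        τ (hookLength l c) ^ 2 =
      (∏ i ∈ Icc 1 (t - 1), (τ (-(i : ℤ)) / τ (i : ℤ)) ^ beta t l i) *
        ∏ c ∈ m.cells, τ ((t : ℤ) + content c) / τ (hookLength m c) := by
  obtain ⟨n, hn, c, hc⟩ := h
  -- The values of `τ` at numbers above `t - 1` may vanish, but only those below divide.
  have hD : ∏ i ∈ range t, ∏ k ∈ range i, τ ((k : ℤ) + 1) ≠ 0 := by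
    refine prod_ne_zero_iff.2 fun i hi => prod_ne_zero_iff.2 fun k hk => hτ _ ?_
    rw [mem_range] at hi hk
    rw [mem_Ioo]
    omega
  have hH := prod_ne_zero_iff.2 hmh
  have h1 := prod_hook_mul_prod_sub hm τ
  rw [← prod_image_add_lt _ c, hc] at h1
  have h2 := prod_residue_powers ht hτ (hn.sum_eq_zero ht)
  have h3 := prod_pow_beta ht hn (fun z => τ (-z) / τ z)
  rw [prod_hook_ratio ht hn hl hτ, h3, prod_div_distrib]
  have h4 : (∏ c ∈ m.cells, τ ((t : ℤ) + content c)) / ∏ c ∈ m.cells, τ (hookLength m c) =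
      (∏ v ∈ firstGaps t n, ∏ w ∈ firstGaps t n with w < v, τ (v - w)) /
        ∏ i ∈ range t, ∏ k ∈ range i, τ ((k : ℤ) + 1) := by
    rw [div_eq_div_iff hH hD, ← h1, mul_comm]
  rw [h4, ← h2, ← prod_div_distrib, ← prod_mul_distrib]
  refine prod_congr rfl fun v hv => ?_
  rw [← prod_div_distrib, ← prod_mul_distrib]
  refine prod_congr rfl fun w hw => ?_
  obtain ⟨hw, hlt⟩ := mem_filter.1 hw
  have h5 := emod_mem_Ioo ht hv hw hlt
  have h6 := hτ _ h5
  have h7 : τ (t - (v - w) % t) ≠ 0 := hτ _ (by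
    rw [mem_Ioo] at h5 ⊢
    omega)
  rw [neg_sub, div_pow]
  field_simp

/-! ### The size formula -/

theorem sum_lt_sub_sq (X : Finset ℤ) :
    ∑ x ∈ X, ∑ y ∈ X with y < x, (x - y) ^ 2 = X.card * ∑ x ∈ X, x ^ 2 - (∑ x ∈ X, x) ^ 2 := by
  have h1 := sum_eq_sum_lt X (fun x y => (x - y) ^ 2) (fun v _ => by ring)
  have h2 : ∑ x ∈ X, ∑ y ∈ X with y < x, ((x - y) ^ 2 + (y - x) ^ 2) =
      2 * ∑ x ∈ X, ∑ y ∈ X with y < x, (x - y) ^ 2 := by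
    simp only [mul_sum]
    exact sum_congr rfl fun x _ => sum_congr rfl fun y _ => by ring
  have h3 : ∑ x ∈ X, ∑ y ∈ X, (x - y) ^ 2 =
      2 * (X.card * ∑ x ∈ X, x ^ 2 - (∑ x ∈ X, x) ^ 2) := by
    simp only [sub_sq, sum_add_distrib, sum_sub_distrib, sum_const, nsmul_eq_mul, mul_assoc,
      ← mul_sum, sq (∑ x ∈ X, x), sum_mul_sum]
    ring
  rw [h3, h2] at h1
  linarith

/-- The additive form of `prod_hook_mul_prod_sub` for the function `z ^ 2`; the part that does not
depend on `m` is evaluated by means of the empty diagram. -/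
theorem sum_bead_sq {m : YoungDiagram} (hm : m.colLen 0 ≤ t) :
    ∑ c ∈ m.cells, (((t : ℤ) + content c) ^ 2 - (hookLength m c : ℤ) ^ 2) =
      t * ∑ i ∈ range t, (((m.rowLen i : ℤ)) ^ 2 - 2 * (i + 1) * m.rowLen i) -
        (m.card : ℤ) ^ 2 + m.card * (t * (t + 1)) := by
  have key : ∀ l : YoungDiagram, l.colLen 0 ≤ t →
      ∑ c ∈ l.cells, (((t : ℤ) + content c) ^ 2 - (hookLength l c : ℤ) ^ 2) =
        t * ∑ i ∈ range t, bead l i ^ 2 - (∑ i ∈ range t, bead l i) ^ 2 -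
          ∑ i ∈ range t, ∑ k ∈ range i, ((k : ℤ) + 1) ^ 2 := by
    intro l hl
    have h1 := sum_hook_add_sum_sub hl (fun z : ℤ => z ^ 2)
    rw [sum_lt_sub_sq, sum_topBeads, sum_topBeads, card_topBeads] at h1
    rw [sum_sub_distrib]
    linarith
  -- For the empty diagram the left-hand side vanishes.
  have h0 := key ⊥ (colLen_zero_le (by
    by_contra h
    exact YoungDiagram.notMem_bot _ (YoungDiagram.mem_iff_lt_rowLen.2 (Nat.pos_of_ne_zero h))))
  have hbot : ∀ i, bead ⊥ i = -((i : ℤ) + 1) := by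
    intro i
    have : (⊥ : YoungDiagram).rowLen i = 0 := by
      by_contra h
      exact YoungDiagram.notMem_bot _ (YoungDiagram.mem_iff_lt_rowLen.2 (Nat.pos_of_ne_zero h))
    simp [bead, this]
  simp only [hbot, YoungDiagram.cells_bot, sum_empty, sum_neg_distrib, neg_sq] at h0
  have hG : 2 * ∑ i ∈ range t, ((i : ℤ) + 1) = t * (t + 1) := by
    clear * -
    induction t with
    | zero => simp
    | succ t ih =>
      rw [sum_range_succ, mul_add, ih]
      push_cast
      ring
  have h1 : ∑ i ∈ range t, bead m i = m.card - ∑ i ∈ range t, ((i : ℤ) + 1) := by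
    rw [card_eq_sum_rowLen hm]
    push_cast
    rw [← sum_sub_distrib]
    rfl
  have h2 : ∑ i ∈ range t, bead m i ^ 2 =
      ∑ i ∈ range t, (((m.rowLen i : ℤ)) ^ 2 - 2 * (i + 1) * m.rowLen i) +
        ∑ i ∈ range t, ((i : ℤ) + 1) ^ 2 := by
    rw [← sum_add_distrib]
    refine sum_congr rfl fun i _ => ?_
    simp only [bead]
    ring
  rw [key m hm, h1, h2, ← hG]
  linear_combination -h0

/-- The product formula for `τ z = 2 ^ (z ^ 2)`: the left-hand factor of each box is
`2 ^ (2 * t ^ 2)`, and `τ` is even, so that the factors with `beta` are trivial. -/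
theorem Corresponds.card_mul (ht : 0 < t) {l m : YoungDiagram} (h : Corresponds t l m)
    (hm : m.colLen 0 ≤ t) :
    (l.card : ℤ) * (2 * t ^ 2) =
      ∑ c ∈ m.cells, (((t : ℤ) + content c) ^ 2 - (hookLength m c : ℤ) ^ 2) := by
  have h2 : (2 : ℚ) ≠ 0 := two_ne_zero
  have hne : ∀ z : ℤ, (2 : ℚ) ^ (z ^ 2) ≠ 0 := fun z => zpow_ne_zero _ h2
  have hprod : ∀ (s : Finset (ℕ × ℕ)) (f : ℕ × ℕ → ℤ),
      ∏ c ∈ s, (2 : ℚ) ^ f c = 2 ^ ∑ c ∈ s, f c := by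
    intro s f
    induction s using Finset.cons_induction with
    | empty => simp
    | cons i s hi ih => rw [prod_cons, sum_cons, zpow_add₀ h2, ih]
  have key := h.prod_eq ht hm (τ := fun z => (2 : ℚ) ^ (z ^ 2)) (fun _ _ => hne _)
    (fun _ _ => hne _) (fun _ _ => hne _)
  simp only [neg_sq, div_self (hne _), one_pow, prod_const_one, one_mul] at key
  have hl : ∀ z : ℤ, (2 : ℚ) ^ ((z - t) ^ 2) * 2 ^ ((z + t) ^ 2) / (2 ^ (z ^ 2)) ^ 2 =
      2 ^ (2 * (t : ℤ) ^ 2) := by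
    intro z
    rw [← zpow_natCast, ← zpow_mul, ← zpow_add₀ h2, ← zpow_sub₀ h2]
    congr 1
    push_cast
    ring
  simp only [hl, ← zpow_sub₀ h2] at key
  rw [hprod, hprod, sum_const, nsmul_eq_mul] at key
  exact zpow_right_injective₀ (by norm_num) (by norm_num) key

/-- The size formula for a core and the corresponding residue partition. -/
theorem Corresponds.card_eq (ht : 0 < t) {l m : YoungDiagram} (h : Corresponds t l m)
    (hm : m.colLen 0 ≤ t) :
    (l.card : ℚ) =
      -(m.card : ℚ) * (((m.card : ℚ) + t + (t : ℚ) ^ 2) / (2 * (t : ℚ) ^ 2)) +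
        ∑ i ∈ range t, ((m.rowLen i : ℚ) ^ 2
          + 2 * ((t : ℚ) + 1 - ((i : ℚ) + 1)) * (m.rowLen i : ℚ)) / (2 * (t : ℚ)) := by
  have ht0 : (t : ℚ) ≠ 0 := by positivity
  have h1 := (h.card_mul ht hm).trans (sum_bead_sq hm)
  have h2 : (l.card : ℚ) * (2 * t ^ 2) =
      t * ∑ i ∈ range t, ((m.rowLen i : ℚ) ^ 2 - 2 * (i + 1) * m.rowLen i) -
        (m.card : ℚ) ^ 2 + m.card * (t * (t + 1)) := by exact_mod_cast h1
  have h3 : ∑ i ∈ range t, ((m.rowLen i : ℚ) ^ 2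
        + 2 * ((t : ℚ) + 1 - ((i : ℚ) + 1)) * (m.rowLen i : ℚ)) =
      ∑ i ∈ range t, ((m.rowLen i : ℚ) ^ 2 - 2 * ((i : ℚ) + 1) * (m.rowLen i : ℚ)) +
        2 * ((t : ℚ) + 1) * (m.card : ℚ) := by
    rw [card_eq_sum_rowLen hm]
    push_cast
    rw [mul_sum, ← sum_add_distrib]
    exact sum_congr rfl fun i _ => by ring
  rw [← sum_div, h3]
  generalize ∑ i ∈ range t, ((m.rowLen i : ℚ) ^ 2 - 2 * ((i : ℚ) + 1) * (m.rowLen i : ℚ)) = S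
    at h2 ⊢
  field_simp
  linear_combination h2

end

end MultisetHook

theorem theorem6p2 (t : ℕ) (ht : 0 < t) :
    ∃ ψ : YoungDiagram → YoungDiagram,
      Set.BijOn ψ {l | MultisetHook.IsCore t l} {m | MultisetHook.IsResiduePartition t m} ∧
      (∀ l : YoungDiagram, MultisetHook.IsCore t l →
        (l.card : ℚ) =
          -((ψ l).card : ℚ) * ((((ψ l).card : ℚ) + t + (t : ℚ) ^ 2) / (2 * (t : ℚ) ^ 2)) +
            ∑ i ∈ Finset.range t,
              (((ψ l).rowLen i : ℚ) ^ 2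
                + 2 * ((t : ℚ) + 1 - ((i : ℚ) + 1)) * ((ψ l).rowLen i : ℚ)) / (2 * (t : ℚ))) ∧
      (∀ (F : Type*) [Field F] (τ : ℤ → F) (l : YoungDiagram), MultisetHook.IsCore t l →
        (∀ c ∈ l.cells, τ (MultisetHook.hookLength l c) ≠ 0) →
        (∀ i ∈ Finset.Icc 1 (t - 1), τ (i : ℤ) ≠ 0) →
        (∀ c ∈ (ψ l).cells, τ (MultisetHook.hookLength (ψ l) c) ≠ 0) →
        ∏ c ∈ l.cells,
            τ ((MultisetHook.hookLength l c : ℤ) - t) * τ ((MultisetHook.hookLength l c : ℤ) + t) /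
              τ (MultisetHook.hookLength l c) ^ 2 =
          (∏ i ∈ Finset.Icc 1 (t - 1),
            (τ (-(i : ℤ)) / τ (i : ℤ)) ^ MultisetHook.beta t l i) *
          ∏ c ∈ (ψ l).cells,
            τ ((t : ℤ) + MultisetHook.content c) / τ (MultisetHook.hookLength (ψ l) c)) := by
  obtain ⟨ψ, hbij, hcor⟩ := MultisetHook.exists_bijOn_corresponds ht
  have hlen : ∀ l, MultisetHook.IsCore t l → (ψ l).colLen 0 ≤ t := fun l hl =>
    (MultisetHook.isResiduePartition_iff.1 (hbij.mapsTo hl)).1.trans (Nat.sub_le t 1)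
  refine ⟨ψ, hbij, fun l hl => (hcor l hl).card_eq ht (hlen l hl), ?_⟩
  intro F _ τ l hl h1 h2 h3
  refine (hcor l hl).prod_eq ht (hlen l hl) h1 (fun z hz => ?_) h3
  rw [Finset.mem_Ioo] at hz
  have h4 := h2 z.toNat (by rw [Finset.mem_Icc]; omega)
  rwa [Int.toNat_of_nonneg hz.1.le] at h4
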